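/- Let $\mathbb{F}$ be an infinite field of characteristic two, and let $L(X)$ be the free Lie algebra over $\mathbb{F}$ with free generators $x_1,x_2,\ldots$. Write $uv$ for the Lie product and $u_1u_2\cdots u_n=(\cdots((u_1u_2)u_3)\cdots)u_n$ for the left-normed product. A T-ideal of $L(X)$ is an ideal stable under all substitutions $x_1\mapsto g_1,\ x_2\mapsto g_2,\ldots$ with $g_i\in L(X)$, and the T-ideal generated by a set is the smallest T-ideal containing it. Let $\mathrm{gl}_2$ be the Lie algebra of all $2\times 2$ matrices over $\mathbb{F}$ with product $[A,B]=A\cdot B-B\cdot A$, and let $T[\mathrm{gl}_2]$ be the ideal of all its polynomial identities, that is, of all $f\in L(X)$ that vanish under every substitution of elements of $\mathrm{gl}_2$ for the generators. Then $T[\mathrm{gl}_2]$ is generated as a T-ideal by the following elements: (a) $(x_1x_2)(x_3x_4)x_5$; (b) $(x_1x_2)(x_1x_2\cdots x_k)$ for all $k>2$; (c) $(x_1x_2)(x_3x_4)+(x_1x_3)(x_2x_4)+(x_1x_4)(x_2x_3)$; (d) $(x_1x_2)(x_3x_4x_5\cdots x_m)+(x_1x_3)(x_2x_4x_5\cdots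 x_m)+(x_1x_4)(x_2x_3x_5\cdots x_m)$ for all $m>4$. -/

import Mathlib

-- The Lie bracket of matrices is the commutator `⁅A, B⁆ = A * B - B * A`.
attribute [local instance] LieRing.ofAssociativeRing

/-- The left-normed product `(⋯((y z₁) z₂) ⋯) zₙ` of a letter `y` and a list `[z₁, …, zₙ]`. -/
def leftNormed {L : Type*} [LieRing L] (y : L) (zs : List L) : L :=
  zs.foldl (fun u z => ⁅u, z⁆) y

/-- The ideal of all polynomial identities of a Lie algebra `L` over `F`, inside the free Lie
algebra on countably many generators: those `f` which vanish under every substitution of elements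
of `L` for the generators. -/
noncomputable def identityIdeal (F : Type*) [CommRing F] (L : Type*) [LieRing L] [LieAlgebra F L] :
    LieIdeal F (FreeLieAlgebra F ℕ) where
  carrier := {f | ∀ a : ℕ → L, FreeLieAlgebra.lift F a f = 0}
  add_mem' := by
    intro f g hf hg a
    rw [map_add, hf a, hg a, add_zero]
  zero_mem' := by
    intro a
    exact map_zero _
  smul_mem' := by
    intro c f hf a
    rw [map_smul, hf a, smul_zero]
  lie_mem := by
    intro g f hf a
    rw [LieHom.map_lie, hf a, lie_zero]

/-- A T-ideal: an ideal of the free Lie algebra which is stable with respect to all substitutions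
of elements of the free Lie algebra for the generators. -/
def IsTIdeal {F : Type*} [CommRing F] (I : LieIdeal F (FreeLieAlgebra F ℕ)) : Prop :=
  ∀ g : ℕ → FreeLieAlgebra F ℕ, ∀ f ∈ I, FreeLieAlgebra.lift F g f ∈ I

/-- The T-ideal generated by a set: the intersection of all T-ideals containing it. -/
noncomputable def tIdealSpan (F : Type*) [CommRing F] (S : Set (FreeLieAlgebra F ℕ)) :
    LieIdeal F (FreeLieAlgebra F ℕ) :=
  sInf {I | IsTIdeal I ∧ ∀ f ∈ S, f ∈ I}

/-- The free generator `xᵢ`. The identities below only mention `x₁, x₂, …`. -/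
noncomputable def letter (F : Type*) [CommRing F] (i : ℕ) : FreeLieAlgebra F ℕ :=
  FreeLieAlgebra.of F i

/-- The list `xₛ, xₛ₊₁, …, xₜ` (empty if `t < s`). -/
noncomputable def letters (F : Type*) [CommRing F] (s t : ℕ) : List (FreeLieAlgebra F ℕ) :=
  (List.range' s (t + 1 - s)).map (letter F)

/-- `(x₁ x₂)(x₃ x₄) x₅`. -/
noncomputable def identityA (F : Type*) [CommRing F] : FreeLieAlgebra F ℕ :=
  ⁅⁅⁅letter F 1, letter F 2⁆, ⁅letter F 3, letter F 4⁆⁆, letter F 5⁆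

/-- `(x₁ x₂)(x₁ x₂ ⋯ xₖ)`. -/
noncomputable def identityB (F : Type*) [CommRing F] (k : ℕ) : FreeLieAlgebra F ℕ :=
  ⁅⁅letter F 1, letter F 2⁆, leftNormed (letter F 1) (letters F 2 k)⁆

/-- `(x₁ x₂)(x₃ x₄) + (x₁ x₃)(x₂ x₄) + (x₁ x₄)(x₂ x₃)`. -/
noncomputable def identityC (F : Type*) [CommRing F] : FreeLieAlgebra F ℕ :=
  ⁅⁅letter F 1, letter F 2⁆, ⁅letter F 3, letter F 4⁆⁆ + ⁅⁅letter F 1, letter F 3⁆, ⁅letter F 2, letter F 4⁆⁆ +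
    ⁅⁅letter F 1, letter F 4⁆, ⁅letter F 2, letter F 3⁆⁆

/-- `(x₁ x₂)(x₃ x₄ x₅ ⋯ xₘ) + (x₁ x₃)(x₂ x₄ x₅ ⋯ xₘ) + (x₁ x₄)(x₂ x₃ x₅ ⋯ xₘ)`; in each summand
every letter `x₁, …, xₘ` occurs exactly once. -/
noncomputable def identityD (F : Type*) [CommRing F] (m : ℕ) : FreeLieAlgebra F ℕ :=
  ⁅⁅letter F 1, letter F 2⁆, leftNormed (letter F 3) (letter F 4 :: letters F 5 m)⁆ +
    ⁅⁅letter F 1, letter F 3⁆, leftNormed (letter F 2) (letter F 4 :: letters F 5 m)⁆ +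
    ⁅⁅letter F 1, letter F 4⁆, leftNormed (letter F 2) (letter F 3 :: letters F 5 m)⁆

/-! ## The identities of `gl₂` in characteristic two

Both inclusions go through the laws `SatisfiesLaws`, the identities (a)–(d) read in an arbitrary
Lie ring.

*The laws hold in `gl₂`* (`satisfiesLaws_matrix`). In characteristic two the identity matrix is
traceless, commutators of commutators are scalar, and modulo scalars a matrix acts on traceless
matrices as multiplication by its trace. So the product of two elements of `gl₂'` is the symplectic
form on a two-dimensional space, and the laws are its alternation and a Plücker-type relation.

*A Lie algebra `Q` with these laws satisfies all identities of `gl₂`.* As the field is infinite, an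
identity vanishes on the generic matrices `[[tᵢ, aᵢ], [bᵢ, 0]]`. In each of the two steps
below, a linear map from polynomials to `Q` sends a suitable entry of the generic value of `f` back
to the value of `f` in `Q`, so that `f` vanishes in `Q` if this entry is zero. The first step treats
all `f` in the free Lie algebra `L`, the second those in `L''`.

* If `Q` is metabelian (`lift_eq_zero_of_metabelian`), the upper right entry of the value of
  `xᵢ xⱼ m` is `(tᵢ aⱼ + tⱼ aᵢ) tᵐ`. Given a letter `c` of the multidegree, the retraction sends
  `aᵢ` to `xᵢ`, and for `m ≠ 0` it sends `aᵢ tᵐ` to `xᵢ x_c ⋯` if `i ≠ c`, to `0` if `i = c`. With `Q = L / L''`, every identity of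
  `gl₂` lies in `L''`.
* If `Q` satisfies the laws (`SatisfiesLaws.lift_eq_zero_of_generic`), then factors may be moved
  across and permuted inside the products `(xᵢ xⱼ)(xₖ xₗ m)`. The generic value of such a product
  is `tᵢ tₖ w_jl + tᵢ tₗ w_jk + tⱼ tₖ w_il + tⱼ tₗ w_ik` times `tᵐ`, with `w_ik = aᵢ bₖ + aₖ bᵢ`. So
  the retraction amounts to writing the product as a sum of four terms `ψ` that depend on the
  multidegree and on two letters only (`PairingRelations.exists_splitting`). If a letter `a` occurs
  twice, then `ψ i k` is `(xᵢ xₐ)(xₖ xₐ ⋯)`, and (b) makes it alternating. In a multilinear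
  multidegree, fix letters `a`, `b`, `c`; then `ψ a k = 0`, `ψ b c = 0`, otherwise `ψ b k` is
  `(xₐ x_b)(x_c xₖ ⋯)`, and `ψ i k` is `(xₐ xᵢ)(xₖ x_b ⋯) + ψ b i`, which is symmetric by (c), (d)
  and the Jacobi identity.

The second step is applied to the quotient of the free Lie algebra by any T-ideal that contains
(a)–(d).
-/

/-! ### Left-normed products -/

section LeftNormed

variable {L : Type*} [LieRing L]

theorem leftNormed_cons (y z : L) (zs : List L) :
    leftNormed y (z :: zs) = leftNormed ⁅y, z⁆ zs := rfl

theorem leftNormed_append_singleton (y z : L) (zs : List L) :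
    leftNormed y (zs ++ [z]) = ⁅leftNormed y zs, z⁆ := by
  simp [leftNormed]

theorem leftNormed_add (u v : L) (zs : List L) :
    leftNormed (u + v) zs = leftNormed u zs + leftNormed v zs := by
  induction zs generalizing u v with
  | nil => rfl
  | cons z zs ih => simp only [leftNormed_cons, add_lie, ih]

theorem leftNormed_zero (zs : List L) : leftNormed (0 : L) zs = 0 := by
  induction zs with
  | nil => rfl
  | cons z zs ih => simp only [leftNormed_cons, zero_lie, ih]

theorem map_leftNormed {F L' : Type*} [CommRing F] [LieAlgebra F L] [LieRing L'] [LieAlgebra F L']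
    (φ : L →ₗ⁅F⁆ L') (y : L) (zs : List L) :
    φ (leftNormed y zs) = leftNormed (φ y) (zs.map φ) := by
  induction zs generalizing y with
  | nil => rfl
  | cons z zs ih => simp only [List.map_cons, leftNormed_cons, ih, LieHom.map_lie]

end LeftNormed

/-! ### Commutators of two by two matrices in characteristic two -/

section Matrices

variable {R : Type*} [CommRing R]

theorem lie_apply_zero_one (h2 : (2 : R) = 0) (x y : Matrix (Fin 2) (Fin 2) R) :
    ⁅x, y⁆ 0 1 = (x 0 0 + x 1 1) * y 0 1 + (y 0 0 + y 1 1) * x 0 1 := by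
  simp only [LieRing.of_associative_ring_bracket, Matrix.sub_apply, Matrix.mul_apply,
    Fin.sum_univ_two]
  linear_combination (-(x 1 1) * y 0 1 - y 0 0 * x 0 1) * h2

theorem lie_apply_one_zero (h2 : (2 : R) = 0) (x y : Matrix (Fin 2) (Fin 2) R) :
    ⁅x, y⁆ 1 0 = (x 0 0 + x 1 1) * y 1 0 + (y 0 0 + y 1 1) * x 1 0 := by
  simp only [LieRing.of_associative_ring_bracket, Matrix.sub_apply, Matrix.mul_apply,
    Fin.sum_univ_two]
  linear_combination (-(x 0 0) * y 1 0 - y 1 1 * x 1 0) * h2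

theorem lie_apply_zero_zero (h2 : (2 : R) = 0) (x y : Matrix (Fin 2) (Fin 2) R) :
    ⁅x, y⁆ 0 0 = x 0 1 * y 1 0 + x 1 0 * y 0 1 := by
  simp only [LieRing.of_associative_ring_bracket, Matrix.sub_apply, Matrix.mul_apply,
    Fin.sum_univ_two]
  linear_combination (-(x 1 0) * y 0 1) * h2

theorem lie_apply_one_one (h2 : (2 : R) = 0) (x y : Matrix (Fin 2) (Fin 2) R) :
    ⁅x, y⁆ 1 1 = x 0 1 * y 1 0 + x 1 0 * y 0 1 := by
  simp only [LieRing.of_associative_ring_bracket, Matrix.sub_apply, Matrix.mul_apply,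
    Fin.sum_univ_two]
  linear_combination (-(x 0 1) * y 1 0) * h2

theorem lie_diag_eq (h2 : (2 : R) = 0) (x y : Matrix (Fin 2) (Fin 2) R) :
    ⁅x, y⁆ 0 0 = ⁅x, y⁆ 1 1 := by
  rw [lie_apply_zero_zero h2, lie_apply_one_one h2]

/-- Modulo scalars, an element of `gl₂` acts on a traceless matrix as multiplication by its
trace. -/
theorem leftNormed_entries (h2 : (2 : R) = 0) (u : Matrix (Fin 2) (Fin 2) R) (hu : u 0 0 = u 1 1)
    (zs : List (Matrix (Fin 2) (Fin 2) R)) :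
    leftNormed u zs 0 1 = u 0 1 * (zs.map fun z => z 0 0 + z 1 1).prod ∧
      leftNormed u zs 1 0 = u 1 0 * (zs.map fun z => z 0 0 + z 1 1).prod := by
  induction zs generalizing u with
  | nil => simp [leftNormed]
  | cons z zs ih =>
    obtain ⟨h, h'⟩ := ih ⁅u, z⁆ (lie_diag_eq h2 u z)
    simp only [leftNormed_cons, List.map_cons, List.prod_cons, h, h', lie_apply_zero_one h2,
      lie_apply_one_zero h2, hu]
    constructor
    · linear_combination (u 1 1 * z 0 1 * (zs.map fun z => z 0 0 + z 1 1).prod) * h2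
    · linear_combination (u 1 1 * z 1 0 * (zs.map fun z => z 0 0 + z 1 1).prod) * h2

end Matrices

/-! ### The defining identities and Lie algebras satisfying them -/

/-- The identities (a)–(d), read as laws of a Lie ring: products of commutators are central, and
left-normed products of commutators satisfy (b) and the Plücker-type relation (c), (d), for an
arbitrary list `zs` of further factors. -/
structure SatisfiesLaws (L : Type*) [LieRing L] : Prop where
  central : ∀ a b c d e : L, ⁅⁅⁅a, b⁆, ⁅c, d⁆⁆, e⁆ = 0
  alternating : ∀ (a b : L) (zs : List L), ⁅⁅a, b⁆, leftNormed ⁅a, b⁆ zs⁆ = 0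
  plucker : ∀ (a b c d : L) (zs : List L), ⁅⁅a, b⁆, leftNormed ⁅c, d⁆ zs⁆ +
    ⁅⁅a, c⁆, leftNormed ⁅b, d⁆ zs⁆ + ⁅⁅a, d⁆, leftNormed ⁅b, c⁆ zs⁆ = 0

theorem satisfiesLaws_matrix {R : Type*} [CommRing R] (h2 : (2 : R) = 0) :
    SatisfiesLaws (Matrix (Fin 2) (Fin 2) R) where
  central a b c d e := by
    have hu := lie_diag_eq h2 a b
    have hv := lie_diag_eq h2 c d
    have h01 : ⁅⁅a, b⁆, ⁅c, d⁆⁆ 0 1 = 0 := by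
      rw [lie_apply_zero_one h2, hu, hv]
      linear_combination (⁅a, b⁆ 1 1 * ⁅c, d⁆ 0 1 + ⁅c, d⁆ 1 1 * ⁅a, b⁆ 0 1) * h2
    have h10 : ⁅⁅a, b⁆, ⁅c, d⁆⁆ 1 0 = 0 := by
      rw [lie_apply_one_zero h2, hu, hv]
      linear_combination (⁅a, b⁆ 1 1 * ⁅c, d⁆ 1 0 + ⁅c, d⁆ 1 1 * ⁅a, b⁆ 1 0) * h2
    have hd := lie_diag_eq h2 ⁅a, b⁆ ⁅c, d⁆
    generalize ⁅⁅a, b⁆, ⁅c, d⁆⁆ = w at *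
    ext i j
    fin_cases i <;> fin_cases j
    · simp [lie_apply_zero_zero h2, h01, h10]
    · simp only [Fin.zero_eta, Fin.mk_one, lie_apply_zero_one h2, h01, hd, Matrix.zero_apply]
      linear_combination (w 1 1 * e 0 1) * h2
    · simp only [Fin.zero_eta, Fin.mk_one, lie_apply_one_zero h2, h10, hd, Matrix.zero_apply]
      linear_combination (w 1 1 * e 1 0) * h2
    · simp [lie_apply_one_one h2, h01, h10]
  alternating a b zs := by
    have hu := lie_diag_eq h2 a b
    generalize ⁅a, b⁆ = u at *
    obtain ⟨h01, h10⟩ := leftNormed_entries h2 u hu zs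
    have hw : leftNormed u zs 0 0 = leftNormed u zs 1 1 := by
      rcases List.eq_nil_or_concat' zs with rfl | ⟨zs, z, rfl⟩
      · exact hu
      · rw [leftNormed_append_singleton]
        exact lie_diag_eq h2 _ _
    generalize leftNormed u zs = w at *
    generalize (zs.map fun z => z 0 0 + z 1 1).prod = t at *
    ext i j
    fin_cases i <;> fin_cases j
    · simp only [Fin.zero_eta, lie_apply_zero_zero h2, h01, h10, Matrix.zero_apply]
      linear_combination (u 0 1 * u 1 0 * t) * h2
    · simp only [Fin.zero_eta, Fin.mk_one, lie_apply_zero_one h2, hu, hw, Matrix.zero_apply]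
      linear_combination (u 1 1 * w 0 1 + w 1 1 * u 0 1) * h2
    · simp only [Fin.zero_eta, Fin.mk_one, lie_apply_one_zero h2, hu, hw, Matrix.zero_apply]
      linear_combination (u 1 1 * w 1 0 + w 1 1 * u 1 0) * h2
    · simp only [Fin.mk_one, lie_apply_one_one h2, h01, h10, Matrix.zero_apply]
      linear_combination (u 0 1 * u 1 0 * t) * h2
  plucker a b c d zs := by
    have hw (x y : Matrix (Fin 2) (Fin 2) R) :
        leftNormed ⁅x, y⁆ zs 0 0 = leftNormed ⁅x, y⁆ zs 1 1 := by
      rcases List.eq_nil_or_concat' zs with rfl | ⟨zs, z, rfl⟩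
      · exact lie_diag_eq h2 _ _
      · rw [leftNormed_append_singleton]
        exact lie_diag_eq h2 _ _
    have h01 (x y : Matrix (Fin 2) (Fin 2) R) :=
      (leftNormed_entries h2 ⁅x, y⁆ (lie_diag_eq h2 x y) zs).1
    have h10 (x y : Matrix (Fin 2) (Fin 2) R) :=
      (leftNormed_entries h2 ⁅x, y⁆ (lie_diag_eq h2 x y) zs).2
    have hoff (x y z w : Matrix (Fin 2) (Fin 2) R) :
        ⁅⁅x, y⁆, leftNormed ⁅z, w⁆ zs⁆ 0 1 = 0 ∧ ⁅⁅x, y⁆, leftNormed ⁅z, w⁆ zs⁆ 1 0 = 0 := by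
      rw [lie_apply_zero_one h2, lie_apply_one_zero h2, lie_diag_eq h2 x y, hw z w]
      generalize ⁅x, y⁆ = u
      generalize leftNormed ⁅z, w⁆ zs = v
      constructor
      · linear_combination (u 1 1 * v 0 1 + v 1 1 * u 0 1) * h2
      · linear_combination (u 1 1 * v 1 0 + v 1 1 * u 1 0) * h2
    have h00 : (⁅⁅a, b⁆, leftNormed ⁅c, d⁆ zs⁆ + ⁅⁅a, c⁆, leftNormed ⁅b, d⁆ zs⁆ +
        ⁅⁅a, d⁆, leftNormed ⁅b, c⁆ zs⁆) 0 0 = 0 := by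
      simp only [Matrix.add_apply, lie_apply_zero_zero h2, h01, h10, lie_apply_zero_one h2,
        lie_apply_one_zero h2]
      generalize (zs.map fun z => z 0 0 + z 1 1).prod = t
      have hsum (A B C D a₁ a₂ b₁ b₂ c₁ c₂ d₁ d₂ : R) :
          (A * b₁ + B * a₁) * ((C * d₂ + D * c₂) * t) +
            (A * b₂ + B * a₂) * ((C * d₁ + D * c₁) * t) +
          ((A * c₁ + C * a₁) * ((B * d₂ + D * b₂) * t) +
            (A * c₂ + C * a₂) * ((B * d₁ + D * b₁) * t)) +
          ((A * d₁ + D * a₁) * ((B * c₂ + C * b₂) * t) +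
            (A * d₂ + D * a₂) * ((B * c₁ + C * b₁) * t)) = 0 := by
        linear_combination t * (A * C * (b₁ * d₂ + b₂ * d₁) + A * D * (b₁ * c₂ + b₂ * c₁) +
          B * C * (a₁ * d₂ + a₂ * d₁) + B * D * (a₁ * c₂ + a₂ * c₁) +
          A * B * (c₁ * d₂ + c₂ * d₁) + C * D * (a₁ * b₂ + a₂ * b₁)) * h2
      exact hsum _ _ _ _ _ _ _ _ _ _ _ _
    have h11 (x y z w : Matrix (Fin 2) (Fin 2) R) := lie_diag_eq h2 ⁅x, y⁆ (leftNormed ⁅z, w⁆ zs)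
    ext i j
    fin_cases i <;> fin_cases j
    · exact h00
    · simp only [Fin.zero_eta, Fin.mk_one, Matrix.add_apply, hoff, add_zero, Matrix.zero_apply]
    · simp only [Fin.zero_eta, Fin.mk_one, Matrix.add_apply, hoff, add_zero, Matrix.zero_apply]
    · simpa only [Fin.mk_one, Matrix.add_apply, h11, Matrix.zero_apply] using h00

section Identities

variable {F : Type*} [CommRing F]

theorem lift_lift {L : Type*} [LieRing L] [LieAlgebra F L] (a : ℕ → L)
    (g : ℕ → FreeLieAlgebra F ℕ) (f : FreeLieAlgebra F ℕ) :
    FreeLieAlgebra.lift F a (FreeLieAlgebra.lift F g f) =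
      FreeLieAlgebra.lift F (fun i => FreeLieAlgebra.lift F a (g i)) f := by
  have h : (FreeLieAlgebra.lift F a).comp (FreeLieAlgebra.lift F g) =
      FreeLieAlgebra.lift F (fun i => FreeLieAlgebra.lift F a (g i)) :=
    FreeLieAlgebra.hom_ext fun i => by simp
  exact LieHom.congr_fun h f

theorem isTIdeal_identityIdeal (L : Type*) [LieRing L] [LieAlgebra F L] :
    IsTIdeal (identityIdeal F L) := by
  intro g f hf a
  rw [lift_lift]
  exact hf _

theorem lift_identityA {L : Type*} [LieRing L] [LieAlgebra F L] (a : ℕ → L) :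
    FreeLieAlgebra.lift F a (identityA F) = ⁅⁅⁅a 1, a 2⁆, ⁅a 3, a 4⁆⁆, a 5⁆ := by
  simp [identityA, letter]

theorem map_letters {L : Type*} [LieRing L] [LieAlgebra F L] (a : ℕ → L) (s t : ℕ) :
    (letters F s t).map (FreeLieAlgebra.lift F a) = (List.range' s (t + 1 - s)).map a := by
  simp [letters, letter, Function.comp_def]

theorem letters_succ_le {s t : ℕ} (h : s ≤ t) :
    letters F s t = letter F s :: letters F (s + 1) t := by
  rw [letters, letters, show t + 1 - s = (t + 1 - (s + 1)) + 1 by omega, List.range'_succ,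
    List.map_cons]

theorem lift_identityB {L : Type*} [LieRing L] [LieAlgebra F L] (a : ℕ → L) {k : ℕ} (hk : 2 ≤ k) :
    FreeLieAlgebra.lift F a (identityB F k) =
      ⁅⁅a 1, a 2⁆, leftNormed ⁅a 1, a 2⁆ ((List.range' 3 (k + 1 - 3)).map a)⁆ := by
  rw [identityB, letters_succ_le hk, leftNormed_cons, LieHom.map_lie, map_leftNormed, map_letters]
  simp [letter]

theorem lift_identityC {L : Type*} [LieRing L] [LieAlgebra F L] (a : ℕ → L) :
    FreeLieAlgebra.lift F a (identityC F) = ⁅⁅a 1, a 2⁆, ⁅a 3, a 4⁆⁆ + ⁅⁅a 1, a 3⁆, ⁅a 2, a 4⁆⁆ +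
      ⁅⁅a 1, a 4⁆, ⁅a 2, a 3⁆⁆ := by
  simp [identityC, letter]

theorem lift_identityD {L : Type*} [LieRing L] [LieAlgebra F L] (a : ℕ → L) (m : ℕ) :
    FreeLieAlgebra.lift F a (identityD F m) =
      ⁅⁅a 1, a 2⁆, leftNormed ⁅a 3, a 4⁆ ((List.range' 5 (m + 1 - 5)).map a)⁆ +
      ⁅⁅a 1, a 3⁆, leftNormed ⁅a 2, a 4⁆ ((List.range' 5 (m + 1 - 5)).map a)⁆ +
      ⁅⁅a 1, a 4⁆, leftNormed ⁅a 2, a 3⁆ ((List.range' 5 (m + 1 - 5)).map a)⁆ := by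
  simp only [identityD, leftNormed_cons, map_add, LieHom.map_lie, map_leftNormed, map_letters,
    letter, FreeLieAlgebra.lift_of_apply]

/-- The set of generators (a)–(d). -/
def lawSet (F : Type*) [CommRing F] : Set (FreeLieAlgebra F ℕ) :=
  {identityA F} ∪ {f | ∃ k : ℕ, 2 < k ∧ f = identityB F k} ∪
    {identityC F} ∪ {f | ∃ m : ℕ, 4 < m ∧ f = identityD F m}

theorem SatisfiesLaws.lift_eq_zero {L : Type*} [LieRing L] [LieAlgebra F L]
    (h : SatisfiesLaws L) (a : ℕ → L) {f : FreeLieAlgebra F ℕ} (hf : f ∈ lawSet F) :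
    FreeLieAlgebra.lift F a f = 0 := by
  rcases hf with ((rfl | ⟨k, hk, rfl⟩) | rfl) | ⟨m, -, rfl⟩
  · rw [lift_identityA]
    exact h.central _ _ _ _ _
  · rw [lift_identityB a hk.le]
    exact h.alternating _ _ _
  · rw [lift_identityC]
    exact h.plucker _ _ _ _ []
  · rw [lift_identityD]
    exact h.plucker _ _ _ _ _

/-- The canonical projection onto the quotient by an ideal, as a homomorphism of Lie algebras. -/
noncomputable def quotientHom (J : LieIdeal F (FreeLieAlgebra F ℕ)) :
    FreeLieAlgebra F ℕ →ₗ⁅F⁆ FreeLieAlgebra F ℕ ⧸ J :=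
  { (LieSubmodule.Quotient.mk' J : FreeLieAlgebra F ℕ →ₗ[F] FreeLieAlgebra F ℕ ⧸ J) with
    map_lie' := fun {x y} => LieSubmodule.Quotient.mk_bracket (I := J) x y }

theorem quotientHom_eq_zero {J : LieIdeal F (FreeLieAlgebra F ℕ)} {f : FreeLieAlgebra F ℕ} :
    quotientHom J f = 0 ↔ f ∈ J :=
  LieSubmodule.Quotient.mk_eq_zero J

theorem quotientHom_surjective (J : LieIdeal F (FreeLieAlgebra F ℕ)) :
    Function.Surjective (quotientHom J) :=
  LieSubmodule.Quotient.surjective_mk' J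

theorem lift_quotientHom (J : LieIdeal F (FreeLieAlgebra F ℕ)) (f : FreeLieAlgebra F ℕ) :
    FreeLieAlgebra.lift F (fun i => quotientHom J (FreeLieAlgebra.of F i)) f = quotientHom J f :=
  LieHom.congr_fun (FreeLieAlgebra.lift_comp_of (quotientHom J)) f

/-- The elements of a T-ideal are identities of the quotient by it. -/
theorem IsTIdeal.lift_quotient_eq_zero {J : LieIdeal F (FreeLieAlgebra F ℕ)} (hJ : IsTIdeal J)
    {f : FreeLieAlgebra F ℕ} (hf : f ∈ J) (a : ℕ → FreeLieAlgebra F ℕ ⧸ J) :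
    FreeLieAlgebra.lift F a f = 0 := by
  choose g hg using fun i => quotientHom_surjective J (a i)
  have : a = fun i =>
      FreeLieAlgebra.lift F (fun i => quotientHom J (FreeLieAlgebra.of F i)) (g i) := by
    funext i
    rw [lift_quotientHom, hg]
  rw [this, ← lift_lift, lift_quotientHom, quotientHom_eq_zero]
  exact hJ g f hf

theorem exists_seq_of_list {L : Type*} (a : ℕ → L) (s : ℕ) (zs : List L) :
    ∃ b : ℕ → L, (∀ i < s, b i = a i) ∧ (List.range' s zs.length).map b = zs := by
  refine ⟨fun i => if i < s then a i else zs.getD (i - s) (a 0), fun i hi => if_pos hi, ?_⟩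
  apply List.ext_getElem
  · simp
  · intro n h1 h2
    simp [h2]

theorem IsTIdeal.satisfiesLaws {J : LieIdeal F (FreeLieAlgebra F ℕ)} (hJ : IsTIdeal J)
    (h : ∀ f ∈ lawSet F, f ∈ J) : SatisfiesLaws (FreeLieAlgebra F ℕ ⧸ J) where
  central a b c d e := by
    have := hJ.lift_quotient_eq_zero (h _ (.inl (.inl (.inl rfl))))
      (fun i => [a, a, b, c, d, e].getD i a)
    rwa [lift_identityA] at this
  alternating a b zs := by
    rcases zs with _ | ⟨z, zs⟩
    · exact lie_self _
    obtain ⟨g, hg, hzs⟩ := exists_seq_of_list (fun i => [a, a, b].getD i a) 3 (z :: zs)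
    have := hJ.lift_quotient_eq_zero
      (h _ (.inl (.inl (.inr ⟨zs.length + 3, by omega, rfl⟩)))) g
    rwa [lift_identityB _ (by omega), show zs.length + 3 + 1 - 3 = (z :: zs).length by simp, hzs,
      hg 1 (by omega), hg 2 (by omega)] at this
  plucker a b c d zs := by
    rcases zs with _ | ⟨z, zs⟩
    · have := hJ.lift_quotient_eq_zero (h _ (.inl (.inr rfl))) (fun i => [a, a, b, c, d].getD i a)
      rwa [lift_identityC] at this
    obtain ⟨g, hg, hzs⟩ := exists_seq_of_list (fun i => [a, a, b, c, d].getD i a) 5 (z :: zs)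
    have := hJ.lift_quotient_eq_zero (h _ (.inr ⟨zs.length + 5, by omega, rfl⟩)) g
    rwa [lift_identityD, show zs.length + 5 + 1 - 5 = (z :: zs).length by simp, hzs,
      hg 1 (by omega), hg 2 (by omega), hg 3 (by omega), hg 4 (by omega)] at this

end Identities

/-! ### Splitting symbols of a fixed multidegree -/

section Splitting

variable {V : Type*} [AddCommGroup V]

theorem neg_eq_self_of_add_self (h2 : ∀ v : V, v + v = 0) (v : V) : -v = v :=
  neg_eq_of_add_eq_zero_left (h2 v)

theorem eq_of_add_eq_zero_of_add_self (h2 : ∀ v : V, v + v = 0) {u v : V} (h : u + v = 0) :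
    u = v := by
  rw [eq_neg_of_add_eq_zero_left h, neg_eq_self_of_add_self h2]

/-- The symbols `b i j m` stand for the products `xᵢ xⱼ m` in a metabelian Lie algebra, where `m`
is a multiset of further letters. -/
theorem exists_splitting_metabelian (h2 : ∀ v : V, v + v = 0) (b : ℕ → ℕ → Multiset ℕ → V)
    (hself : ∀ i m, b i i m = 0) (hsymm : ∀ i j m, b i j m = b j i m)
    (hjac : ∀ i j k m, b i j (k ::ₘ m) + b j k (i ::ₘ m) + b k i (j ::ₘ m) = 0) (S : Multiset ℕ) :
    ∃ φ : ℕ → V, ∀ i j m, i ::ₘ j ::ₘ m = S → b i j m = φ i + φ j := by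
  induction S using Multiset.induction_on with
  | empty => exact ⟨0, fun i j m h => (Multiset.cons_ne_zero h).elim⟩
  | cons a S _ =>
    refine ⟨fun i => if i = a then 0 else b i a (S.erase i), fun i j m h => ?_⟩
    by_cases hi : i = a
    · subst hi
      obtain rfl : j ::ₘ m = S := by simpa using h
      by_cases hj : j = i
      · simp [hj, hself]
      · simp [hj, hsymm]
    by_cases hj : j = a
    · subst hj
      obtain rfl : i ::ₘ m = S := by
        rw [Multiset.cons_swap] at h
        simpa using h
      simp [hi]
    have ha : a ∈ m := by
      have : a ∈ i ::ₘ j ::ₘ m := h ▸ Multiset.mem_cons_self a S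
      simpa [Ne.symm hi, Ne.symm hj] using this
    obtain ⟨m, rfl⟩ := Multiset.exists_cons_of_mem ha
    obtain rfl : i ::ₘ j ::ₘ m = S := by
      rw [Multiset.cons_swap j, Multiset.cons_swap i] at h
      simpa using h
    have e : (i ::ₘ j ::ₘ m).erase j = i ::ₘ m := by rw [Multiset.cons_swap]; simp
    simp only [hi, hj, if_false, e, Multiset.erase_cons_head]
    apply eq_of_add_eq_zero_of_add_self h2
    rw [← hjac i j a m, hsymm a i]
    abel

/-- The relations between the symbols `B i j k l m`, which stand for the products
`(xᵢ xⱼ)(xₖ xₗ m)`, where `m` is a multiset of further letters. -/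
structure PairingRelations (B : ℕ → ℕ → ℕ → ℕ → Multiset ℕ → V) : Prop where
  self : ∀ i k l m, B i i k l m = 0
  symm : ∀ i j k l m, B i j k l m = B j i k l m
  swap : ∀ i j k l m, B i j k l m = B k l i j m
  alternating : ∀ i j m, B i j i j m = 0
  jacobi : ∀ i j k l p m, B i j k l (p ::ₘ m) + B i j l p (k ::ₘ m) + B i j p k (l ::ₘ m) = 0
  plucker : ∀ i j k l m, B i j k l m + B i k j l m + B i l j k m = 0

namespace PairingRelations

variable {B : ℕ → ℕ → ℕ → ℕ → Multiset ℕ → V}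

theorem symm_right (hB : PairingRelations B) (i j k l : ℕ) (m : Multiset ℕ) :
    B i j k l m = B i j l k m := by
  rw [hB.swap, hB.symm, hB.swap]

theorem expand_right (h2 : ∀ v : V, v + v = 0) (hB : PairingRelations B) (i j k l a : ℕ)
    (m : Multiset ℕ) : B i j k l (a ::ₘ m) = B i j k a (l ::ₘ m) + B i j l a (k ::ₘ m) := by
  apply eq_of_add_eq_zero_of_add_self h2
  rw [← hB.jacobi i j k l a m, hB.symm_right i j a k]
  abel

theorem expand_left (h2 : ∀ v : V, v + v = 0) (hB : PairingRelations B) (i j k l a : ℕ)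
    (m : Multiset ℕ) : B i j k l (a ::ₘ m) = B i a k l (j ::ₘ m) + B j a k l (i ::ₘ m) := by
  rw [hB.swap, hB.expand_right h2, hB.swap, hB.swap k l j a]

/-- In a multidegree `S` with a repeated letter `a`, moving `a` into both commutators splits the
symbols. -/
theorem exists_splitting_of_repeated (h2 : ∀ v : V, v + v = 0) (hB : PairingRelations B)
    (a : ℕ) (S : Multiset ℕ) :
    ∃ ψ : ℕ → ℕ → V, (∀ i k, ψ i k = ψ k i) ∧ (∀ i, ψ i i = 0) ∧
      ∀ i j k l m, i ::ₘ j ::ₘ k ::ₘ l ::ₘ m = a ::ₘ a ::ₘ S →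
        B i j k l m = ψ i k + ψ i l + ψ j k + ψ j l := by
  set ψ : ℕ → ℕ → V := fun i k =>
    if i = a ∨ k = a then 0 else B i a k a ((S.erase i).erase k) with hψ
  have hsymm i k : ψ i k = ψ k i := by
    simp only [hψ, or_comm (a := i = a), hB.swap i, Multiset.erase_comm]
  have hleft k : ψ a k = 0 := by simp [hψ]
  have hright k : ψ k a = 0 := by simp [hψ]
  have hval {i k m} (hi : i ≠ a) (hk : k ≠ a) (h : i ::ₘ k ::ₘ m = S) :
      ψ i k = B i a k a m := by
    subst h
    simp [hψ, hi, hk]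
  refine ⟨ψ, hsymm, fun i => ?_, ?_⟩
  · simp only [hψ, hB.alternating, ite_self]
  -- The case where `a` is the first letter.
  have hfirst i j k l m (hi : i = a) (h : i ::ₘ j ::ₘ k ::ₘ l ::ₘ m = a ::ₘ a ::ₘ S) :
      B i j k l m = ψ i k + ψ i l + ψ j k + ψ j l := by
    subst hi
    simp only [Multiset.cons_inj_right] at h
    simp only [hleft, zero_add]
    by_cases hj : j = i
    · subst hj
      simp [hB.self, hleft]
    by_cases hk : k = i
    · subst hk
      have h' : j ::ₘ l ::ₘ m = S := by
        rw [Multiset.cons_swap] at h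
        simpa using h
      by_cases hl : l = k
      · subst hl
        rw [hB.swap, hB.self, hright, add_zero]
      · rw [hright, zero_add, hval hj hl h', hB.symm, hB.symm_right]
    by_cases hl : l = i
    · subst hl
      have h' : j ::ₘ k ::ₘ m = S := by
        rw [Multiset.cons_swap k, Multiset.cons_swap j] at h
        simpa using h
      rw [hright, add_zero, hval hj hk h', hB.symm]
    have ha : i ∈ m := by
      have : i ∈ j ::ₘ k ::ₘ l ::ₘ m := h ▸ Multiset.mem_cons_self i S
      simpa [Ne.symm hj, Ne.symm hk, Ne.symm hl] using this
    obtain ⟨m, rfl⟩ := Multiset.exists_cons_of_mem ha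
    have h' : j ::ₘ k ::ₘ l ::ₘ m = S := by
      rw [Multiset.cons_swap l, Multiset.cons_swap k, Multiset.cons_swap j] at h
      simpa using h
    rw [hB.expand_right h2, hB.symm i j, hB.symm i j, hval (m := l ::ₘ m) hj hk h',
      hval (m := k ::ₘ m) hj hl (by rw [← h', Multiset.cons_swap k])]
  have hpair i j k l m (hij : i = a ∨ j = a) (h : i ::ₘ j ::ₘ k ::ₘ l ::ₘ m = a ::ₘ a ::ₘ S) :
      B i j k l m = ψ i k + ψ i l + ψ j k + ψ j l := by
    rcases hij with hi | hj
    · exact hfirst i j k l m hi h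
    · rw [hB.symm, hfirst j i k l m hj (by rw [← h, Multiset.cons_swap])]
      abel
  intro i j k l m h
  by_cases hij : i = a ∨ j = a
  · exact hpair i j k l m hij h
  by_cases hkl : k = a ∨ l = a
  · rw [hB.swap, hpair k l i j m hkl, hsymm k i, hsymm k j, hsymm l i, hsymm l j]
    · abel
    · rw [← h]
      simp only [← Multiset.singleton_add]
      abel
  push Not at hij hkl
  obtain ⟨hi, hj⟩ := hij
  obtain ⟨hk, hl⟩ := hkl
  have hcount : 2 ≤ m.count a := by
    have := congrArg (Multiset.count a) h
    simp [hi.symm, hj.symm, hk.symm, hl.symm] at this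
    omega
  obtain ⟨m, rfl⟩ := Multiset.exists_cons_of_mem (Multiset.count_pos.1 (by omega : 0 < m.count a))
  rw [Multiset.count_cons_self] at hcount
  obtain ⟨m, rfl⟩ := Multiset.exists_cons_of_mem (Multiset.count_pos.1 (by omega : 0 < m.count a))
  have h' : i ::ₘ j ::ₘ k ::ₘ l ::ₘ m = S := by
    apply (Multiset.cons_inj_right a).1
    apply (Multiset.cons_inj_right a).1
    rw [← h]
    simp only [← Multiset.singleton_add]
    abel
  have e {p q r s : ℕ} (hS : p ::ₘ q ::ₘ r ::ₘ s ::ₘ m = i ::ₘ j ::ₘ k ::ₘ l ::ₘ m)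
      (hp : p ≠ a) (hq : q ≠ a) : B p a q a (r ::ₘ s ::ₘ m) = ψ p q :=
    (hval hp hq (hS.trans h')).symm
  rw [hB.expand_left h2, Multiset.cons_swap j a, Multiset.cons_swap i a, hB.expand_right h2,
    hB.expand_right h2 j a, e _ hi hk, e _ hi hl, e _ hj hk, e _ hj hl]
  · abel
  all_goals
    simp only [← Multiset.singleton_add]
    abel

/-- In a multilinear multidegree `S`, the splitting is normalised at three letters `a`, `b`, `c`
of `S`. -/
theorem exists_splitting_of_nodup (h2 : ∀ v : V, v + v = 0) (hB : PairingRelations B)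
    {S : Multiset ℕ} (hS : S.Nodup) {a b c : ℕ} (ha : a ∈ S) (hb : b ∈ S) (hc : c ∈ S)
    (hab : a ≠ b) (hac : a ≠ c) (hbc : b ≠ c) :
    ∃ ψ : ℕ → ℕ → V, (∀ i k, ψ i k = ψ k i) ∧ (∀ i, ψ i i = 0) ∧
      ∀ i j k l m, i ::ₘ j ::ₘ k ::ₘ l ::ₘ m = S →
        B i j k l m = ψ i k + ψ i l + ψ j k + ψ j l := by
  have hle (s : List ℕ) : (s : Multiset ℕ) ≤ S ↔ s.Nodup ∧ ∀ x ∈ s, x ∈ S :=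
    ⟨fun h => ⟨Multiset.coe_nodup.1 (Multiset.nodup_of_le h hS), fun x hx =>
      Multiset.mem_of_le h hx⟩, fun h => (Multiset.le_iff_subset (Multiset.coe_nodup.2 h.1)).2 h.2⟩
  set β : ℕ → ℕ → ℕ → ℕ → V := fun i j k l =>
    B i j k l ((((S.erase i).erase j).erase k).erase l) with hβ
  have hval {i j k l m} (h : i ::ₘ j ::ₘ k ::ₘ l ::ₘ m = S) : β i j k l = B i j k l m := by
    subst h
    simp [hβ]
  have bsymm i j k l : β i j k l = β j i k l := by
    simp only [hβ]
    rw [hB.symm, Multiset.erase_comm S]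
  have bright i j k l : β i j k l = β i j l k := by
    simp only [hβ]
    rw [hB.symm_right, Multiset.erase_comm _ k]
  have bswap i j k l : β i j k l = β k l i j := by
    simp only [hβ]
    rw [hB.swap, Multiset.erase_comm _ j k, Multiset.erase_comm _ j l, Multiset.erase_comm _ i k,
      Multiset.erase_comm _ i l]
  have bjac i j k l p (h : [i, j, k, l, p].Nodup) (h' : ∀ x ∈ [i, j, k, l, p], x ∈ S) :
      β i j k l + β i j l p + β i j p k = 0 := by
    obtain ⟨m, hm⟩ := Multiset.le_iff_exists_add.1 ((hle [i, j, k, l, p]).2 ⟨h, h'⟩)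
    simp only [← Multiset.cons_coe, Multiset.coe_nil, Multiset.cons_add, zero_add] at hm
    rw [hval (m := p ::ₘ m) hm.symm, hval (m := k ::ₘ m), hval (m := l ::ₘ m), hB.jacobi]
    all_goals
      rw [hm]
      simp only [← Multiset.singleton_add]
      abel
  have bplu i j k l (h : [i, j, k, l].Nodup) (h' : ∀ x ∈ [i, j, k, l], x ∈ S) :
      β i j k l + β i k j l + β i l j k = 0 := by
    obtain ⟨m, hm⟩ := Multiset.le_iff_exists_add.1 ((hle [i, j, k, l]).2 ⟨h, h'⟩)
    simp only [← Multiset.cons_coe, Multiset.coe_nil, Multiset.cons_add, zero_add] at hm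
    rw [hval hm.symm, hval (m := m), hval (m := m), hB.plucker]
    all_goals
      rw [hm]
      simp only [← Multiset.singleton_add]
      abel
  set θ : ℕ → V := fun i => if i = c then 0 else β a b c i with hθ
  set ψ : ℕ → ℕ → V := fun i k =>
    if i = k ∨ i = a ∨ k = a ∨ i ∉ S ∨ k ∉ S then 0
    else if i = b then θ k else if k = b then θ i else β a i k b + θ i with hψ
  have ψself i : ψ i i = 0 := by simp [hψ]
  have ψa k : ψ a k = 0 := by simp [hψ]
  have ψb {i} (hi : i ∈ S) (hia : i ≠ a) (hib : i ≠ b) : ψ i b = θ i := by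
    simp [hψ, hi, hb, hia, hib, hab.symm]
  have ψik {i k} (hi : i ∈ S) (hk : k ∈ S) (hik : i ≠ k) (hia : i ≠ a) (hka : k ≠ a)
      (hib : i ≠ b) (hkb : k ≠ b) : ψ i k = β a i k b + θ i := by
    simp [hψ, hi, hk, hik, hia, hka, hib, hkb]
  have θeq {i k} (hi : i ∈ S) (hk : k ∈ S) (hik : i ≠ k) (hia : i ≠ a) (hka : k ≠ a)
      (hib : i ≠ b) (hkb : k ≠ b) : β a b i k = θ i + θ k := by
    by_cases hic : i = c
    · subst hic
      simp [hθ, hik.symm]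
    by_cases hkc : k = c
    · subst hkc
      simp [hθ, hik, bright a b i k]
    simp only [hθ, hic, hkc, if_false]
    apply eq_of_add_eq_zero_of_add_self h2
    rw [← bjac a b i k c (by simp; tauto) (by simp; tauto), bright a b c k]
    abel
  have ψsymm i k : ψ i k = ψ k i := by
    by_cases h : i = k ∨ i = a ∨ k = a ∨ i ∉ S ∨ k ∉ S
    · have h' : k = i ∨ k = a ∨ i = a ∨ k ∉ S ∨ i ∉ S := by tauto
      simp only [hψ, h, h', if_true]
    push Not at h
    obtain ⟨hik, hia, hka, hi, hk⟩ := h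
    by_cases hib : i = b
    · subst hib
      rw [ψb hk hka hik.symm]
      simp [hψ, hi, hk, hik, hia, hka]
    by_cases hkb : k = b
    · subst hkb
      rw [ψb hi hia hib]
      simp [hψ, hi, hk, hik.symm, hia, hka]
    rw [ψik hi hk hik hia hka hib hkb, ψik hk hi hik.symm hka hia hkb hib]
    apply eq_of_add_eq_zero_of_add_self h2
    have h := bplu a b i k (by simp; tauto) (by simp; tauto)
    rw [θeq hi hk hik hia hka hib hkb, bright a i, bright a k] at h
    rw [← h]
    abel
  refine ⟨ψ, ψsymm, ψself, fun i j k l m hm => ?_⟩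
  obtain ⟨hd, hmem⟩ := (hle [i, j, k, l]).1 (by
    rw [← hm]
    simp only [← Multiset.cons_coe, Multiset.coe_nil]
    simp)
  rw [← hval hm]
  clear hm m hθ hψ hβ
  -- The identity to prove inherits the symmetries and the Jacobi relation from both of its sides.
  set G : ℕ → ℕ → ℕ → ℕ → Prop := fun i j k l => β i j k l = ψ i k + ψ i l + ψ j k + ψ j l with hG
  have Gsymm {i j k l} (h : G i j k l) : G j i k l := by
    simp only [hG] at h ⊢
    rw [bsymm, h]
    abel
  have Gswap {i j k l} (h : G i j k l) : G k l i j := by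
    simp only [hG] at h ⊢
    rw [bswap, h, ψsymm i k, ψsymm i l, ψsymm j k, ψsymm j l]
    abel
  have Gright {i j k l} (h : G i j k l) : G i j l k := Gswap (Gsymm (Gswap h))
  have Gjac {i j k l} p (h : [i, j, k, l, p].Nodup) (h' : ∀ x ∈ [i, j, k, l, p], x ∈ S)
      (h₁ : G i j p k) (h₂ : G i j p l) : G i j k l := by
    have h₂' := Gright h₂
    simp only [hG] at h₁ h₂' ⊢
    have e : β i j k l = β i j l p + β i j p k := by
      apply eq_of_add_eq_zero_of_add_self h2
      rw [← bjac i j k l p h h', add_assoc]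
    rw [e, h₁, h₂']
    have e₁ := h2 (ψ i p)
    have e₂ := h2 (ψ j p)
    calc _ = (ψ i k + ψ i l + ψ j k + ψ j l) + (ψ i p + ψ i p) + (ψ j p + ψ j p) := by abel
      _ = _ := by rw [e₁, e₂, add_zero, add_zero]
  have Gab {k l} (hk : k ∈ S) (hl : l ∈ S) (hkl : k ≠ l) (hka : k ≠ a) (hla : l ≠ a)
      (hkb : k ≠ b) (hlb : l ≠ b) : G a b k l := by
    simp only [hG]
    rw [ψa, ψa, ψsymm b k, ψsymm b l, ψb hk hka hkb, ψb hl hla hlb,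
      θeq hk hl hkl hka hla hkb hlb, zero_add, zero_add]
  have Gb {i k} (hi : i ∈ S) (hk : k ∈ S) (hik : i ≠ k) (hia : i ≠ a) (hka : k ≠ a)
      (hib : i ≠ b) (hkb : k ≠ b) : G a i b k := by
    apply Gright
    simp only [hG]
    rw [ψa, ψa, ψik hi hk hik hia hka hib hkb, ψb hi hia hib, zero_add, zero_add, add_assoc, h2,
      add_zero]
  have Ga {i k l} (h : [a, i, k, l].Nodup) (h' : ∀ x ∈ [a, i, k, l], x ∈ S) : G a i k l := by
    have h1 := h
    have h1' := h'
    simp only [List.nodup_cons, List.mem_cons, List.not_mem_nil, or_false, not_or, forall_eq_or_imp,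
      forall_eq, not_false_eq_true, List.nodup_nil, and_true] at h1 h1'
    obtain ⟨⟨hai, hak, hal⟩, ⟨hik, hil⟩, hkl⟩ := h1
    obtain ⟨-, hi, hk, hl⟩ := h1'
    by_cases hib : i = b
    · subst hib
      exact Gab hk hl hkl (Ne.symm hak) (Ne.symm hal) (Ne.symm hik) (Ne.symm hil)
    by_cases hkb : k = b
    · subst hkb
      exact Gb hi hl hil (Ne.symm hai) (Ne.symm hal) hib (Ne.symm hkl)
    by_cases hlb : l = b
    · subst hlb
      exact Gright (Gb hi hk hik (Ne.symm hai) (Ne.symm hak) hib hkl)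
    exact Gjac b (by simp; tauto) (by simp; tauto)
      (Gb hi hk hik (Ne.symm hai) (Ne.symm hak) hib hkb)
      (Gb hi hl hil (Ne.symm hai) (Ne.symm hal) hib hlb)
  change G i j k l
  simp only [List.nodup_cons, List.mem_cons, List.not_mem_nil, or_false, not_or, forall_eq_or_imp,
    forall_eq, not_false_eq_true, List.nodup_nil, and_true] at hd hmem
  by_cases hia : i = a
  · subst hia
    exact Ga (by simp; tauto) (by simp; tauto)
  by_cases hja : j = a
  · subst hja
    exact Gsymm (Ga (by simp; tauto) (by simp; tauto))
  by_cases hka : k = a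
  · subst hka
    exact Gswap (Ga (by simp; tauto) (by simp; tauto))
  by_cases hla : l = a
  · subst hla
    exact Gright (Gswap (Ga (by simp; tauto) (by simp; tauto)))
  exact Gjac a (by simp; tauto) (by simp; tauto) (Gswap (Ga (by simp; tauto) (by simp; tauto)))
    (Gswap (Ga (by simp; tauto) (by simp; tauto)))

theorem exists_splitting (h2 : ∀ v : V, v + v = 0) (hB : PairingRelations B) (S : Multiset ℕ) :
    ∃ ψ : ℕ → ℕ → V, (∀ i k, ψ i k = ψ k i) ∧ (∀ i, ψ i i = 0) ∧
      ∀ i j k l m, i ::ₘ j ::ₘ k ::ₘ l ::ₘ m = S →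
        B i j k l m = ψ i k + ψ i l + ψ j k + ψ j l := by
  by_cases hS : S.Nodup
  · by_cases h : ∃ a b c m, a ::ₘ b ::ₘ c ::ₘ m = S
    · obtain ⟨a, b, c, m, rfl⟩ := h
      have hd := hS
      simp only [Multiset.nodup_cons, Multiset.mem_cons, not_or] at hd
      exact hB.exists_splitting_of_nodup h2 hS (a := a) (b := b) (c := c) (by simp) (by simp)
        (by simp) hd.1.1 hd.1.2.1 hd.2.1.1
    · exact ⟨0, fun _ _ => rfl, fun _ => rfl, fun i j k l m hm => (h ⟨i, j, k, _, hm⟩).elim⟩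
  · rw [Multiset.nodup_iff_le] at hS
    push Not at hS
    obtain ⟨a, ha⟩ := hS
    obtain ⟨T, rfl⟩ := Multiset.le_iff_exists_add.1 ha
    simpa using hB.exists_splitting_of_repeated h2 a T

end PairingRelations

end Splitting

/-! ### Spanning words in the free Lie algebra and its derived series -/

section Words

variable {F : Type*} [CommRing F]

/-- The left-normed product `xᵢ xⱼ ⋯` of generators, with the indices after the first two listed
in `s`. -/
noncomputable def word (F : Type*) [CommRing F] (i j : ℕ) (s : List ℕ) : FreeLieAlgebra F ℕ :=
  leftNormed ⁅letter F i, letter F j⁆ (s.map (letter F))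

/-- The span of the left-normed products of at least two generators. -/
noncomputable def wordSpan (F : Type*) [CommRing F] : Submodule F (FreeLieAlgebra F ℕ) :=
  Submodule.span F {u | ∃ i j s, u = word F i j s}

theorem lift_word {L : Type*} [LieRing L] [LieAlgebra F L] (x : ℕ → L) (i j : ℕ) (s : List ℕ) :
    FreeLieAlgebra.lift F x (word F i j s) = leftNormed ⁅x i, x j⁆ (s.map x) := by
  simp [word, map_leftNormed, letter, Function.comp_def]

theorem lie_letter_mem_wordSpan {u : FreeLieAlgebra F ℕ}
    (hu : u ∈ wordSpan F ⊔ Submodule.span F (Set.range (letter F))) (k : ℕ) :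
    ⁅u, letter F k⁆ ∈ wordSpan F := by
  rw [wordSpan, ← Submodule.span_union] at hu
  induction hu using Submodule.span_induction with
  | mem u hu =>
    rcases hu with ⟨i, j, s, rfl⟩ | ⟨i, rfl⟩
    · exact Submodule.subset_span ⟨i, j, s ++ [k], by
        simp [word, leftNormed_append_singleton]⟩
    · exact Submodule.subset_span ⟨i, k, [], rfl⟩
  | zero => simp
  | add u v _ _ hu hv => rw [add_lie]; exact add_mem hu hv
  | smul c u _ hu => rw [smul_lie]; exact Submodule.smul_mem _ _ hu

theorem lie_leftNormed_mem_wordSpan (k : ℕ) (s : List ℕ) {u : FreeLieAlgebra F ℕ}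
    (hu : u ∈ wordSpan F ⊔ Submodule.span F (Set.range (letter F))) :
    ⁅u, leftNormed (letter F k) (s.map (letter F))⁆ ∈ wordSpan F := by
  induction s using List.reverseRecOn generalizing u with
  | nil => exact lie_letter_mem_wordSpan hu k
  | append_singleton s l ih =>
    rw [List.map_append, List.map_singleton, leftNormed_append_singleton, leibniz_lie,
      ← lie_skew (leftNormed (letter F k) (s.map (letter F)))]
    exact add_mem (lie_letter_mem_wordSpan (Submodule.mem_sup_left (ih hu)) l)
      (neg_mem (ih (Submodule.mem_sup_left (lie_letter_mem_wordSpan hu l))))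

theorem lie_mem_wordSpan {u v : FreeLieAlgebra F ℕ}
    (hu : u ∈ wordSpan F ⊔ Submodule.span F (Set.range (letter F)))
    (hv : v ∈ wordSpan F ⊔ Submodule.span F (Set.range (letter F))) : ⁅u, v⁆ ∈ wordSpan F := by
  rw [wordSpan, ← Submodule.span_union] at hv
  induction hv using Submodule.span_induction with
  | mem v hv =>
    rcases hv with ⟨i, j, s, rfl⟩ | ⟨i, rfl⟩
    · exact lie_leftNormed_mem_wordSpan i (j :: s) hu
    · exact lie_letter_mem_wordSpan hu i
  | zero => simp
  | add v w _ _ hv hw => rw [lie_add]; exact add_mem hv hw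
  | smul c v _ hv => rw [lie_smul]; exact Submodule.smul_mem _ _ hv

theorem mem_wordSpan_sup (f : FreeLieAlgebra F ℕ) :
    f ∈ wordSpan F ⊔ Submodule.span F (Set.range (letter F)) := by
  let K : LieSubalgebra F (FreeLieAlgebra F ℕ) :=
    { wordSpan F ⊔ Submodule.span F (Set.range (letter F)) with
      lie_mem' := fun hu hv => Submodule.mem_sup_left (lie_mem_wordSpan hu hv) }
  let g : FreeLieAlgebra F ℕ →ₗ⁅F⁆ K := FreeLieAlgebra.lift F fun i =>
    ⟨letter F i, Submodule.mem_sup_right (Submodule.subset_span ⟨i, rfl⟩)⟩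
  -- The corestriction `g` to the subalgebra `K` is a section of its inclusion.
  have h : K.incl.comp g = LieHom.id := FreeLieAlgebra.hom_ext fun i => by simp [g, letter]
  have hf : (g f : FreeLieAlgebra F ℕ) = f := LieHom.congr_fun h f
  rw [← hf]
  exact (g f).2

theorem derivedSeries_one_le_wordSpan :
    (LieAlgebra.derivedSeries F (FreeLieAlgebra F ℕ) 1 : Submodule F (FreeLieAlgebra F ℕ)) ≤
      wordSpan F := by
  rw [LieAlgebra.coe_derivedSeries_one_eq, Submodule.span_le]
  rintro _ ⟨u, v, rfl⟩
  exact lie_mem_wordSpan (mem_wordSpan_sup u) (mem_wordSpan_sup v)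

theorem mem_span_of_mem_derivedSeries_two {f : FreeLieAlgebra F ℕ}
    (hf : f ∈ LieAlgebra.derivedSeries F (FreeLieAlgebra F ℕ) 2) :
    f ∈ Submodule.span F {f | ∃ i j s k l t, f = ⁅word F i j s, word F k l t⁆} := by
  rw [LieAlgebra.derivedSeries_def, LieAlgebra.derivedSeriesOfIdeal_succ,
    ← LieSubmodule.mem_toSubmodule, LieSubmodule.lieIdeal_oper_eq_linear_span'] at hf
  revert f
  change Submodule.span F _ ≤ _
  rw [Submodule.span_le]
  rintro _ ⟨u, hu, v, hv, rfl⟩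
  replace hu := derivedSeries_one_le_wordSpan hu
  replace hv := derivedSeries_one_le_wordSpan hv
  rw [wordSpan] at hu
  induction hu using Submodule.span_induction with
  | mem u hu =>
    obtain ⟨i, j, s, rfl⟩ := hu
    rw [wordSpan] at hv
    induction hv using Submodule.span_induction with
    | mem v hv =>
      obtain ⟨k, l, t, rfl⟩ := hv
      exact Submodule.subset_span ⟨i, j, s, k, l, t, rfl⟩
    | zero => simp
    | add v w _ _ hv hw => rw [lie_add]; exact add_mem hv hw
    | smul c v _ hv => rw [lie_smul]; exact Submodule.smul_mem _ _ hv
  | zero => simp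
  | add u w _ _ hu hw => rw [add_lie]; exact add_mem hu hw
  | smul c u _ hu => rw [smul_lie]; exact Submodule.smul_mem _ _ hu

end Words

/-! ### Products in metabelian and in centre-by-metabelian Lie rings -/

section Metabelian

variable {Q : Type*} [LieRing Q]

theorem lie_lie_cyclic (a b c : Q) : ⁅⁅a, b⁆, c⁆ + ⁅⁅b, c⁆, a⁆ + ⁅⁅c, a⁆, b⁆ = 0 := by
  rw [← lie_skew ⁅a, b⁆ c, ← lie_skew ⁅b, c⁆ a, ← lie_skew ⁅c, a⁆ b, ← neg_add, ← neg_add,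
    lie_jacobi, neg_zero]

theorem leftNormed_perm_of_metabelian (hQ : ∀ a b c d : Q, ⁅⁅a, b⁆, ⁅c, d⁆⁆ = 0)
    {zs ws : List Q} (h : zs.Perm ws) (u v : Q) : leftNormed ⁅u, v⁆ zs = leftNormed ⁅u, v⁆ ws := by
  induction h generalizing u v with
  | nil => rfl
  | cons z _ ih => exact ih ⁅u, v⁆ z
  | swap y z zs =>
    rw [leftNormed_cons, leftNormed_cons, leftNormed_cons, leftNormed_cons, lie_lie, hQ, zero_sub,
      lie_skew]
  | trans _ _ ih₁ ih₂ => rw [ih₁, ih₂]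

theorem exists_splitting_of_metabelian (h2 : ∀ u : Q, u + u = 0)
    (hQ : ∀ a b c d : Q, ⁅⁅a, b⁆, ⁅c, d⁆⁆ = 0) (x : ℕ → Q) :
    ∃ φ : ℕ → Multiset ℕ → Q, ∀ i j (s : List ℕ),
      leftNormed ⁅x i, x j⁆ (s.map x) = φ j (i ::ₘ s) + φ i (j ::ₘ s) := by
  have hperm i j (s : List ℕ) :
      leftNormed ⁅x i, x j⁆ (s.map x) = leftNormed ⁅x i, x j⁆ ((s : Multiset ℕ).toList.map x) :=
    leftNormed_perm_of_metabelian hQ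
      ((Multiset.coe_eq_coe.1 (Multiset.coe_toList (s : Multiset ℕ))).symm.map x) _ _
  choose φ hφ using exists_splitting_metabelian h2
    (fun i j m => leftNormed ⁅x i, x j⁆ (m.toList.map x))
    (fun i m => by rw [lie_self, leftNormed_zero])
    (fun i j m => by rw [← lie_skew, neg_eq_self_of_add_self h2])
    (fun i j k m => by
      have hcons i j k : leftNormed ⁅x i, x j⁆ ((k ::ₘ m).toList.map x) =
          leftNormed ⁅⁅x i, x j⁆, x k⁆ (m.toList.map x) := by
        have h := hperm i j (k :: m.toList)
        rw [← Multiset.cons_coe, Multiset.coe_toList] at h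
        exact h.symm
      rw [hcons, hcons, hcons, ← leftNormed_add, ← leftNormed_add, lie_lie_cyclic,
        leftNormed_zero])
  refine ⟨fun i m => φ (i ::ₘ m) i, fun i j s => ?_⟩
  rw [hperm, hφ _ i j s rfl, add_comm]
  simp only [Multiset.cons_swap j i]

end Metabelian

section Pairing

variable {Q : Type*} [LieRing Q]

theorem exists_leftNormed_eq_lie (a b : Q) (zs : List Q) :
    ∃ c d : Q, leftNormed ⁅a, b⁆ zs = ⁅c, d⁆ := by
  induction zs generalizing a b with
  | nil => exact ⟨a, b, rfl⟩
  | cons z zs ih => exact ih ⁅a, b⁆ z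

namespace SatisfiesLaws

theorem lie_leftNormed_lie_lie (hQ : SatisfiesLaws Q) (u a b c d : Q) (zs : List Q) :
    ⁅u, leftNormed ⁅⁅a, b⁆, ⁅c, d⁆⁆ zs⁆ = 0 := by
  rcases zs with _ | ⟨z, zs⟩
  · rw [← lie_skew]
    exact neg_eq_zero.2 (hQ.central a b c d u)
  · rw [leftNormed_cons, hQ.central, leftNormed_zero, lie_zero]

theorem lie_leftNormed_perm (hQ : SatisfiesLaws Q) {zs ws : List Q} (h : zs.Perm ws)
    (a u v : Q) : ⁅a, leftNormed ⁅u, v⁆ zs⁆ = ⁅a, leftNormed ⁅u, v⁆ ws⁆ := by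
  induction h generalizing u v with
  | nil => rfl
  | cons z _ ih => exact ih ⁅u, v⁆ z
  | swap y z zs =>
    have e : ⁅⁅⁅u, v⁆, z⁆, y⁆ = ⁅⁅u, v⁆, ⁅z, y⁆⁆ + ⁅⁅⁅u, v⁆, y⁆, z⁆ := by
      rw [lie_lie ⁅u, v⁆, ← lie_skew ⁅⁅u, v⁆, y⁆, sub_eq_add_neg]
    simp only [leftNormed_cons]
    rw [← add_zero ⁅a, leftNormed ⁅⁅⁅u, v⁆, y⁆, z⁆ zs⁆,
      ← hQ.lie_leftNormed_lie_lie a u v z y zs, ← lie_add, ← leftNormed_add, add_comm, ← e]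
  | trans _ _ ih₁ ih₂ => rw [ih₁, ih₂]

/-- Since products of commutators are central, a factor can be moved from one commutator of such a
product to the other; no sign appears in characteristic two. -/
theorem lie_leftNormed_move (h2 : ∀ u : Q, u + u = 0) (hQ : SatisfiesLaws Q) (a b c d : Q)
    (zs ws : List Q) : ⁅leftNormed ⁅a, b⁆ zs, leftNormed ⁅c, d⁆ ws⁆ =
      ⁅⁅a, b⁆, leftNormed ⁅c, d⁆ (ws ++ zs)⁆ := by
  induction zs generalizing a b ws with
  | nil => simp [leftNormed]
  | cons z zs ih =>
    rw [leftNormed_cons, ih, hQ.lie_leftNormed_perm (List.perm_middle (l₁ := ws)),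
      hQ.lie_leftNormed_perm (List.perm_append_singleton z (ws ++ zs)).symm,
      leftNormed_append_singleton]
    obtain ⟨e, f, hef⟩ := exists_leftNormed_eq_lie c d (ws ++ zs)
    have h := hQ.central a b e f z
    rw [lie_lie, sub_eq_zero] at h
    rw [hef, h, ← lie_skew, neg_eq_self_of_add_self h2]

theorem pairingRelations (h2 : ∀ u : Q, u + u = 0) (hQ : SatisfiesLaws Q) (x : ℕ → Q) :
    PairingRelations fun i j k l (m : Multiset ℕ) =>
      ⁅⁅x i, x j⁆, leftNormed ⁅x k, x l⁆ (m.toList.map x)⁆ where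
  self i k l m := by rw [lie_self, zero_lie]
  symm i j k l m := by rw [← lie_skew (x i), neg_eq_self_of_add_self h2]
  swap i j k l m := by
    rw [← List.nil_append (m.toList.map x), ← hQ.lie_leftNormed_move h2, ← lie_skew,
      neg_eq_self_of_add_self h2, List.nil_append]
    rfl
  alternating i j m := hQ.alternating _ _ _
  plucker i j k l m := hQ.plucker _ _ _ _ _
  jacobi i j k l p m := by
    have hcons k l p : ⁅⁅x i, x j⁆, leftNormed ⁅x k, x l⁆ ((p ::ₘ m).toList.map x)⁆ =
        ⁅⁅x i, x j⁆, leftNormed ⁅⁅x k, x l⁆, x p⁆ (m.toList.map x)⁆ := by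
      have h : (p ::ₘ m).toList.Perm (p :: m.toList) := by
        rw [← Multiset.coe_eq_coe, Multiset.coe_toList, ← Multiset.cons_coe, Multiset.coe_toList]
      exact hQ.lie_leftNormed_perm (h.map x) _ _ _
    rw [hcons, hcons, hcons, ← lie_add, ← lie_add, ← leftNormed_add, ← leftNormed_add,
      lie_lie_cyclic, leftNormed_zero, lie_zero]

theorem exists_splitting (h2 : ∀ u : Q, u + u = 0) (hQ : SatisfiesLaws Q) (x : ℕ → Q) :
    ∃ ψ : ℕ → ℕ → Multiset ℕ → Q, (∀ i k m, ψ i k m = ψ k i m) ∧ (∀ i m, ψ i i m = 0) ∧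
      ∀ i j k l (s t : List ℕ),
        ⁅leftNormed ⁅x i, x j⁆ (s.map x), leftNormed ⁅x k, x l⁆ (t.map x)⁆ =
          ψ i k (j ::ₘ l ::ₘ (t + s)) + ψ i l (j ::ₘ k ::ₘ (t + s)) +
          ψ j k (i ::ₘ l ::ₘ (t + s)) + ψ j l (i ::ₘ k ::ₘ (t + s)) := by
  choose ψ hsymm hself hψ using (hQ.pairingRelations h2 x).exists_splitting h2
  refine ⟨fun i k m => ψ (i ::ₘ k ::ₘ m) i k, fun i k m => ?_, fun i m => hself _ _,
    fun i j k l s t => ?_⟩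
  · simp only [hsymm _ i k, Multiset.cons_swap i k]
  · have hs : ((t + s : Multiset ℕ)).toList.Perm (t ++ s) := by
      rw [← Multiset.coe_eq_coe, Multiset.coe_toList, Multiset.coe_add]
    rw [hQ.lie_leftNormed_move h2, ← List.map_append, ← hQ.lie_leftNormed_perm (hs.map x),
      hψ _ i j k l _ rfl]
    congr 1
    · congr 1
      · congr 1
        all_goals
          congr 1
          simp only [← Multiset.singleton_add]
          abel
      · congr 1
        simp only [← Multiset.singleton_add]
        abel
    · congr 1
      simp only [← Multiset.singleton_add]
      abel

end SatisfiesLaws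

end Pairing

/-! ### Generic matrices and retractions from polynomials -/

section Generic

variable {F : Type*} [Field F]

/-- The generic matrices `[[tᵢ, aᵢ], [bᵢ, 0]]`, where `tᵢ`, `aᵢ`, `bᵢ` are the indeterminates
`X (0, i)`, `X (1, i)`, `X (2, i)`. A scalar matrix may be subtracted from each argument of a
commutator, so the lower right entry can be taken to be zero. -/
noncomputable def genericMatrix (F : Type*) [Field F] (i : ℕ) :
    Matrix (Fin 2) (Fin 2) (MvPolynomial (Fin 3 × ℕ) F) :=
  !![MvPolynomial.X (0, i), MvPolynomial.X (1, i); MvPolynomial.X (2, i), 0]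

theorem lift_genericMatrix_eq_zero [Infinite F] {f : FreeLieAlgebra F ℕ}
    (hf : f ∈ identityIdeal F (Matrix (Fin 2) (Fin 2) F)) :
    FreeLieAlgebra.lift F (genericMatrix F) f = 0 := by
  ext1 r s
  apply MvPolynomial.funext
  intro v
  let e : Matrix (Fin 2) (Fin 2) (MvPolynomial (Fin 3 × ℕ) F) →ₗ⁅F⁆ Matrix (Fin 2) (Fin 2) F :=
    ((MvPolynomial.aeval v : MvPolynomial (Fin 3 × ℕ) F →ₐ[F] F).mapMatrix (m := Fin 2)).toLieHom
  have h : e.comp (FreeLieAlgebra.lift F (genericMatrix F)) =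
      FreeLieAlgebra.lift F fun i => e (genericMatrix F i) :=
    FreeLieAlgebra.hom_ext fun i => by simp
  have h' : e (FreeLieAlgebra.lift F (genericMatrix F) f) = 0 :=
    (LieHom.congr_fun h f).trans (hf _)
  have h'' := congrFun (congrFun h' r) s
  simpa [e, MvPolynomial.aeval_eq_eval] using h''

/-- The monomial with the multisets `m`, `p`, `q` of indices of its factors `tᵢ`, `aᵢ`, `bᵢ`. -/
noncomputable def monomialOf (F : Type*) [Field F] (m p q : Multiset ℕ) :
    MvPolynomial (Fin 3 × ℕ) F :=
  (m.map fun i => MvPolynomial.X (0, i)).prod * (p.map fun i => MvPolynomial.X (1, i)).prod *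
    (q.map fun i => MvPolynomial.X (2, i)).prod

theorem map_X_prod_eq_monomial (c : Fin 3) (m : Multiset ℕ) :
    (m.map fun i => (MvPolynomial.X (c, i) : MvPolynomial (Fin 3 × ℕ) F)).prod =
      MvPolynomial.monomial (m.map fun i => Finsupp.single (c, i) 1).sum 1 := by
  induction m using Multiset.induction_on with
  | empty => simp
  | cons i m ih =>
    rw [Multiset.map_cons, Multiset.prod_cons, ih, Multiset.map_cons, Multiset.sum_cons,
      MvPolynomial.X, MvPolynomial.monomial_mul, mul_one]

/-- A linear map out of the polynomial ring can be prescribed on the monomials. -/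
theorem exists_linearMap_monomialOf {Q : Type*} [AddCommGroup Q] [Module F Q]
    (Ψ : Multiset ℕ → Multiset ℕ → Multiset ℕ → Q) :
    ∃ lam : MvPolynomial (Fin 3 × ℕ) F →ₗ[F] Q, ∀ m p q, lam (monomialOf F m p q) = Ψ m p q := by
  let d (c : Fin 3) : (Fin 3 × ℕ →₀ ℕ) →+ Multiset ℕ := Finsupp.liftAddHom fun r =>
    multiplesHom (Multiset ℕ) (if r.1 = c then {r.2} else 0)
  have hd c c' (m : Multiset ℕ) : d c (m.map fun i => Finsupp.single (c', i) 1).sum =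
      if c' = c then m else 0 := by
    induction m using Multiset.induction_on with
    | empty => simp
    | cons i m ih =>
      rw [Multiset.map_cons, Multiset.sum_cons, map_add, ih]
      split_ifs with h <;> simp [d, h]
  refine ⟨(MvPolynomial.basisMonomials (Fin 3 × ℕ) F).constr F
    fun s => Ψ (d 0 s) (d 1 s) (d 2 s), fun m p q => ?_⟩
  rw [monomialOf, map_X_prod_eq_monomial, map_X_prod_eq_monomial, map_X_prod_eq_monomial,
    MvPolynomial.monomial_mul, MvPolynomial.monomial_mul, mul_one, mul_one,
    ← congrFun (MvPolynomial.coe_basisMonomials (Fin 3 × ℕ) F), Module.Basis.constr_basis]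
  simp [hd]

variable [CharP F 2]

theorem two_eq_zero_mvPolynomial : (2 : MvPolynomial (Fin 3 × ℕ) F) = 0 := by
  have h := congrArg (MvPolynomial.C (σ := Fin 3 × ℕ)) (CharTwo.two_eq_zero (R := F))
  rwa [map_ofNat, map_zero] at h

theorem genericMatrix_lie_entries (i j : ℕ) (s : List ℕ) :
    leftNormed ⁅genericMatrix F i, genericMatrix F j⁆ (s.map (genericMatrix F)) 0 1 =
        monomialOf F (i ::ₘ s) {j} 0 + monomialOf F (j ::ₘ s) {i} 0 ∧
      leftNormed ⁅genericMatrix F i, genericMatrix F j⁆ (s.map (genericMatrix F)) 1 0 =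
        monomialOf F (i ::ₘ s) 0 {j} + monomialOf F (j ::ₘ s) 0 {i} := by
  have h2 := two_eq_zero_mvPolynomial (F := F)
  obtain ⟨h, h'⟩ := leftNormed_entries h2 _ (lie_diag_eq h2 (genericMatrix F i) (genericMatrix F j))
    (s.map (genericMatrix F))
  rw [h, h', lie_apply_zero_one h2, lie_apply_one_zero h2]
  have e : ((s.map (genericMatrix F)).map fun z => z 0 0 + z 1 1) =
      s.map fun i => MvPolynomial.X (0, i) := by simp [genericMatrix, Function.comp_def]
  rw [e]
  simp only [monomialOf, genericMatrix, Multiset.map_cons, Multiset.map_coe, Multiset.prod_cons,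
    Multiset.prod_coe, Multiset.map_singleton, Multiset.prod_singleton, Multiset.map_zero,
    Multiset.prod_zero, Matrix.of_apply, Matrix.cons_val', Matrix.cons_val_zero,
    Matrix.cons_val_one, Matrix.cons_val_fin_one, add_zero]
  constructor <;> ring

theorem add_self_of_charTwo {Q : Type*} [AddCommGroup Q] [Module F Q] (u : Q) : u + u = 0 := by
  rw [← two_smul F u, CharTwo.two_eq_zero, zero_smul]

/-- An element of the free Lie algebra whose generic value has vanishing upper right entry is an
identity of every metabelian Lie algebra. -/
theorem lift_eq_zero_of_metabelian {Q : Type*} [LieRing Q] [LieAlgebra F Q]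
    (hQ : ∀ a b c d : Q, ⁅⁅a, b⁆, ⁅c, d⁆⁆ = 0) (x : ℕ → Q) {f : FreeLieAlgebra F ℕ}
    (hf : FreeLieAlgebra.lift F (genericMatrix F) f 0 1 = 0) : FreeLieAlgebra.lift F x f = 0 := by
  obtain ⟨φ, hφ⟩ := exists_splitting_of_metabelian (add_self_of_charTwo (F := F)) hQ x
  obtain ⟨lam, hlam⟩ := exists_linearMap_monomialOf (F := F)
    fun m p _ => (p.map fun i => if m = 0 then x i else φ i m).sum
  have key : FreeLieAlgebra.lift F x f = lam (FreeLieAlgebra.lift F (genericMatrix F) f 0 1) := by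
    have hmem := mem_wordSpan_sup f
    rw [wordSpan, ← Submodule.span_union] at hmem
    clear hf
    induction hmem using Submodule.span_induction with
    | mem u hu =>
      rcases hu with ⟨i, j, s, rfl⟩ | ⟨i, rfl⟩
      · rw [lift_word, lift_word, (genericMatrix_lie_entries i j s).1, map_add, hlam, hlam, hφ]
        simp
      · have e : FreeLieAlgebra.lift F (genericMatrix F) (letter F i) 0 1 =
            monomialOf F 0 {i} 0 := by simp [letter, genericMatrix, monomialOf]
        rw [e, hlam]
        simp [letter]
    | zero => simp
    | add u v _ _ hu hv => rw [map_add, map_add, Matrix.add_apply, map_add, hu, hv]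
    | smul c u _ hu => rw [map_smul, map_smul, Matrix.smul_apply, map_smul, hu]
  rw [key, hf, map_zero]

theorem mem_derivedSeries_two {f : FreeLieAlgebra F ℕ}
    (hf : FreeLieAlgebra.lift F (genericMatrix F) f = 0) :
    f ∈ LieAlgebra.derivedSeries F (FreeLieAlgebra F ℕ) 2 := by
  rw [← quotientHom_eq_zero, ← lift_quotientHom]
  refine lift_eq_zero_of_metabelian (fun a b c d => ?_) _ (by rw [hf]; rfl)
  obtain ⟨a, rfl⟩ := quotientHom_surjective _ a
  obtain ⟨b, rfl⟩ := quotientHom_surjective _ b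
  obtain ⟨c, rfl⟩ := quotientHom_surjective _ c
  obtain ⟨d, rfl⟩ := quotientHom_surjective _ d
  rw [← LieHom.map_lie, ← LieHom.map_lie, ← LieHom.map_lie, quotientHom_eq_zero]
  have h (u v : FreeLieAlgebra F ℕ) :
      ⁅u, v⁆ ∈ LieAlgebra.derivedSeries F (FreeLieAlgebra F ℕ) 1 := by
    rw [LieAlgebra.derivedSeries_def, LieAlgebra.derivedSeriesOfIdeal_succ]
    exact LieSubmodule.lie_mem_lie (LieSubmodule.mem_top u) (LieSubmodule.mem_top v)
  rw [LieAlgebra.derivedSeries_def, LieAlgebra.derivedSeriesOfIdeal_succ]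
  exact LieSubmodule.lie_mem_lie (h a b) (h c d)

/-- A Lie algebra satisfying (a)–(d) satisfies every element of the free Lie algebra that vanishes
on the generic matrices. -/
theorem SatisfiesLaws.lift_eq_zero_of_generic {Q : Type*} [LieRing Q] [LieAlgebra F Q]
    (hQ : SatisfiesLaws Q) (x : ℕ → Q) {f : FreeLieAlgebra F ℕ}
    (hf : FreeLieAlgebra.lift F (genericMatrix F) f = 0) : FreeLieAlgebra.lift F x f = 0 := by
  obtain ⟨ψ, hsymm, hself, hψ⟩ := hQ.exists_splitting (add_self_of_charTwo (F := F)) x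
  -- Of the two monomials of `tᵐ (aᵢ bₖ + aₖ bᵢ)`, only the one with the smaller index at `a`
  -- is used.
  obtain ⟨lam, hlam⟩ := exists_linearMap_monomialOf (F := F)
    fun m p q => (p.map fun i => (q.map fun k => if i < k then ψ i k m else 0).sum).sum
  have hminor i k m : lam (monomialOf F m {i} {k} + monomialOf F m {k} {i}) = ψ i k m := by
    rw [map_add, hlam, hlam]
    rcases lt_trichotomy i k with h | rfl | h
    · simp [h, h.not_gt]
    · simp [hself]
    · simp [h, h.not_gt, hsymm i k]
  have hmul m p m' q : monomialOf F m p 0 * monomialOf F m' 0 q = monomialOf F (m + m') p q := by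
    simp only [monomialOf, Multiset.map_add, Multiset.prod_add, Multiset.map_zero,
      Multiset.prod_zero]
    ring
  have key : FreeLieAlgebra.lift F x f = lam (FreeLieAlgebra.lift F (genericMatrix F) f 0 0) := by
    have hmem := mem_span_of_mem_derivedSeries_two (mem_derivedSeries_two hf)
    clear hf
    induction hmem using Submodule.span_induction with
    | mem u hu =>
      obtain ⟨i, j, s, k, l, t, rfl⟩ := hu
      rw [LieHom.map_lie, LieHom.map_lie, lift_word, lift_word, lift_word, lift_word, hψ,
        lie_apply_zero_zero two_eq_zero_mvPolynomial, (genericMatrix_lie_entries i j s).1,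
        (genericMatrix_lie_entries i j s).2, (genericMatrix_lie_entries k l t).1,
        (genericMatrix_lie_entries k l t).2, ← hminor, ← hminor, ← hminor, ← hminor,
        ← map_add, ← map_add, ← map_add]
      congr 1
      have hm (p q : ℕ) : p ::ₘ q ::ₘ ((t : Multiset ℕ) + s) = (p ::ₘ s) + (q ::ₘ t) := by
        simp only [← Multiset.singleton_add]
        abel
      simp only [hm, ← hmul]
      have hcomm (i k p q : ℕ) : monomialOf F (i ::ₘ s) {p} 0 * monomialOf F (k ::ₘ t) 0 {q} =
          monomialOf F (k ::ₘ t) {p} 0 * monomialOf F (i ::ₘ s) 0 {q} := by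
        rw [hmul, hmul, add_comm]
      rw [hcomm j l k i, hcomm j k l i, hcomm i l k j, hcomm i k l j]
      ring
    | zero => simp
    | add u v _ _ hu hv => rw [map_add, map_add, Matrix.add_apply, map_add, hu, hv]
    | smul c u _ hu => rw [map_smul, map_smul, Matrix.smul_apply, map_smul, hu]
  rw [key, hf, Matrix.zero_apply, map_zero]

end Generic

theorem theorem1 (F : Type*) [Field F] [Infinite F] [CharP F 2] :
    identityIdeal F (Matrix (Fin 2) (Fin 2) F) =
      tIdealSpan F ({identityA F} ∪ {f | ∃ k : ℕ, 2 < k ∧ f = identityB F k} ∪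
        {identityC F} ∪ {f | ∃ m : ℕ, 4 < m ∧ f = identityD F m}) := by
  apply le_antisymm
  · refine le_sInf fun J hJ f hf => ?_
    rw [← quotientHom_eq_zero, ← lift_quotientHom]
    exact (hJ.1.satisfiesLaws hJ.2).lift_eq_zero_of_generic _ (lift_genericMatrix_eq_zero hf)
  · exact sInf_le ⟨isTIdeal_identityIdeal _, fun f hf a =>
      (satisfiesLaws_matrix CharTwo.two_eq_zero).lift_eq_zero a hf⟩
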